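/- Definitions. For congruences $\varphi,\theta,\delta$ of an algebra $\mathbf A$, write $C(\varphi,\theta;\delta)$ if for every term $t(x_1,\dots,x_m,y_1,\dots,y_n)$ and all pairs $(a_i,b_i)\in\varphi$ and $(c_j,d_j)\in\theta$, $t(\mathbf a,\mathbf c)\equiv_\delta t(\mathbf a,\mathbf d)$ implies $t(\mathbf b,\mathbf c)\equiv_\delta t(\mathbf b,\mathbf d)$. A congruence $\theta$ is abelian if $C(\theta,\theta;0)$. A ternary term $d(x,y,z)$ is a weak difference term for $\mathbf A$ if $d(a,a,a)=a$ for all $a\in A$, and for all congruences $\delta\le\theta$ of $\mathbf A$ such that the congruence $\theta/\delta$ of $\mathbf A/\delta$ is abelian, $d(a,a,b)\equiv_\delta b\equiv_\delta d(b,a,a)$ for all $(a,b)\in\theta$. It is a weak difference term for a variety $\mathcal V$ if it is one for every algebra in $\mathcal V$. Let $\mathbf F=\mathbf F_{\mathcal V}(3)$ be the $\mathcal V$-free algebra freely generated by $\{x,y,z\}$, let $\alpha=\mathrm{Cg}(x,z)$, $\beta=\mathrm{Cg}(x,y)$, $\gamma=\mathrm{Cg}(y,z)$ be the principal congruences of $\mathbf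 F$, and put $\beta_0=\beta$, $\gamma_0=\gamma$, $\beta_{n+1}=\beta\vee(\alpha\wedge\gamma_n)$, $\gamma_{n+1}=\gamma\vee(\alpha\wedge\beta_n)$ for $n\ge 0$. Theorem. There exists an infinite sequence $\Sigma_0,\Sigma_1,\Sigma_2,\dots$ of finite sets of identities involving variables $x,y$ and ternary operation symbols $\mathsf d,\mathsf f_1,\mathsf f_2,\dots$, such that for every variety $\mathcal V$ and every ternary term $d(x,y,z)$ in the signature of $\mathcal V$, the following are equivalent: (1) $d$ is a weak difference term for $\mathcal V$. (2) For some $n\ge 0$ there exist idempotent ternary terms $f_1,f_2,\dots$ in the signature of $\mathcal V$ such that, when the symbols $\mathsf d,\mathsf f_1,\mathsf f_2,\dots$ are interpreted by $d,f_1,f_2,\dots$ respectively, the identities in $\Sigma_n$ are true in $\mathcal V$. (3) Interpreting $d$ as the element $d^{\mathbf F}(x,y,z)$ of $\mathbf F$, we have $(x,d)\in\gamma_m$ and $(d,z)\in\beta_m$ for some $m\ge 0$. -/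

import Mathlib

universe u v w

namespace UnivAlg

open FirstOrder FirstOrder.Language

/-!
A signature is a first-order language `L` without relation symbols (`[L.IsAlgebraic]`), an
algebra is a nonempty type `A` with `[L.Structure A]`, and terms are `L.Term α`.
-/

/-! ### Congruences -/

/-- A congruence of the algebra `A`: an equivalence relation preserved by all basic operations. -/
@[ext]
structure Congruence (L : FirstOrder.Language.{u, v}) (A : Type w) [L.Structure A] extends Setoid A where
  compat : ∀ {n : ℕ} (f : L.Functions n) (x y : Fin n → A),
    (∀ i, r (x i) (y i)) → r (Structure.funMap f x) (Structure.funMap f y)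

namespace Congruence

variable {L : FirstOrder.Language.{u, v}} {A : Type w} [L.Structure A]

/-- `θ.Rel a b` says that `(a, b) ∈ θ`. -/
def Rel (θ : Congruence L A) (a b : A) : Prop := θ.toSetoid a b

theorem ext_rel {θ φ : Congruence L A} (h : ∀ a b, θ.Rel a b ↔ φ.Rel a b) : θ = φ := by
  cases θ; cases φ
  congr 1
  exact Setoid.ext h

/-- Congruences are ordered by inclusion. -/
instance : PartialOrder (Congruence L A) where
  le θ φ := ∀ a b, θ.Rel a b → φ.Rel a b
  le_refl _ _ _ h := h
  le_trans _ _ _ h₁ h₂ a b h := h₂ a b (h₁ a b h)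
  le_antisymm _ _ h₁ h₂ := ext_rel fun a b => ⟨h₁ a b, h₂ a b⟩

/-- The intersection of a set of congruences. -/
instance : InfSet (Congruence L A) where
  sInf S :=
    { r := fun a b => ∀ θ ∈ S, θ.Rel a b
      iseqv := ⟨fun a θ _ => θ.refl' a, fun h θ hθ => θ.symm' (h θ hθ),
        fun h₁ h₂ θ hθ => θ.trans' (h₁ θ hθ) (h₂ θ hθ)⟩
      compat := fun f x y h θ hθ => θ.compat f x y fun i => h i θ hθ }

/-- The congruence lattice of `A`: the meet of two congruences is their intersection, and the
join is the least congruence containing both. -/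
instance : CompleteLattice (Congruence L A) where
  __ := completeLatticeOfInf (Congruence L A) fun _ =>
    ⟨fun θ hθ _ _ h => h θ hθ, fun _ hφ a b h θ hθ => hφ hθ a b h⟩
  inf θ φ :=
    { r := fun a b => θ.Rel a b ∧ φ.Rel a b
      iseqv := ⟨fun a => ⟨θ.refl' a, φ.refl' a⟩, fun h => ⟨θ.symm' h.1, φ.symm' h.2⟩,
        fun h₁ h₂ => ⟨θ.trans' h₁.1 h₂.1, φ.trans' h₁.2 h₂.2⟩⟩
      compat := fun f x y h =>
        ⟨θ.compat f x y fun i => (h i).1, φ.compat f x y fun i => (h i).2⟩ }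
  inf_le_left _ _ _ _ h := h.1
  inf_le_right _ _ _ _ h := h.2
  le_inf _ _ _ h₁ h₂ a b h := ⟨h₁ a b h, h₂ a b h⟩
  bot :=
    { r := fun a b => a = b
      iseqv := ⟨fun _ => rfl, Eq.symm, Eq.trans⟩
      compat := fun f _ _ h => congrArg (Structure.funMap f) (funext h) }
  bot_le θ a b h := by
    have h' : a = b := h
    subst h'
    exact θ.refl' a
  top :=
    { r := fun _ _ => True
      iseqv := ⟨fun _ => trivial, fun _ => trivial, fun _ _ => trivial⟩
      compat := fun _ _ _ _ => trivial }
  le_top _ _ _ _ := trivial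

/-- The principal congruence `Cg(a, b)`: the least congruence containing `(a, b)`. -/
def cg (L : FirstOrder.Language.{u, v}) {A : Type w} [L.Structure A] (a b : A) : Congruence L A :=
  sInf {θ | θ.Rel a b}

instance prestructure [L.IsAlgebraic] (θ : Congruence L A) : L.Prestructure θ.toSetoid where
  toStructure := inferInstance
  fun_equiv {_ f} x y h := θ.compat f x y h
  rel_equiv {_ r} := isEmptyElim r

/-- The quotient algebra `A/θ`, with the operations induced on classes. -/
abbrev Quot [L.IsAlgebraic] (θ : Congruence L A) : Type w := Quotient θ.toSetoid

/-- For `δ ≤ θ`, the congruence `θ/δ` of `A/δ`. -/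
def modulo [L.IsAlgebraic] (θ δ : Congruence L A) (hle : δ ≤ θ) : Congruence L δ.Quot where
  r p q := ∃ a b : A, Quotient.mk _ a = p ∧ Quotient.mk _ b = q ∧ θ.Rel a b
  iseqv := by
    refine ⟨?_, ?_, ?_⟩
    · rintro ⟨a⟩
      exact ⟨a, a, rfl, rfl, θ.refl' a⟩
    · rintro _ _ ⟨a, b, ha, hb, h⟩
      exact ⟨b, a, hb, ha, θ.symm' h⟩
    · rintro _ _ _ ⟨a, b, ha, hb, h⟩ ⟨b', c, hb', hc, h'⟩
      have hbb : δ.Rel b b' := Quotient.exact (hb.trans hb'.symm)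
      exact ⟨a, c, ha, hc, θ.trans' h (θ.trans' (hle _ _ hbb) h')⟩
  compat := by
    intro n f x y h
    choose a b ha hb hab using h
    obtain rfl : (fun i => Quotient.mk _ (a i)) = x := funext ha
    obtain rfl : (fun i => Quotient.mk _ (b i)) = y := funext hb
    exact ⟨Structure.funMap f a, Structure.funMap f b,
      (funMap_quotient_mk' δ.toSetoid f a).symm, (funMap_quotient_mk' δ.toSetoid f b).symm,
      θ.compat f a b hab⟩

/-- `C(φ, θ; δ)`: `φ` centralizes `θ` modulo `δ` (the term condition). -/
def Centralizes (φ θ δ : Congruence L A) : Prop :=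
  ∀ (m n : ℕ) (t : L.Term (Fin m ⊕ Fin n)) (a b : Fin m → A) (c d : Fin n → A),
    (∀ i, φ.Rel (a i) (b i)) → (∀ j, θ.Rel (c j) (d j)) →
    δ.Rel (t.realize (Sum.elim a c)) (t.realize (Sum.elim a d)) →
    δ.Rel (t.realize (Sum.elim b c)) (t.realize (Sum.elim b d))

/-- `θ` is abelian: `C(θ, θ; 0)`. -/
def IsAbelian (θ : Congruence L A) : Prop := Centralizes θ θ ⊥

/-- The two sequences `(β_n, γ_n)` given by `β_0 = β`, `γ_0 = γ`,
`β_{n+1} = β ∨ (α ∧ γ_n)`, `γ_{n+1} = γ ∨ (α ∧ β_n)`. -/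
def betaGamma (α β γ : Congruence L A) : ℕ → Congruence L A × Congruence L A
  | 0 => (β, γ)
  | n + 1 => (β ⊔ (α ⊓ (betaGamma α β γ n).2), γ ⊔ (α ⊓ (betaGamma α β γ n).1))

end Congruence

/-! ### Varieties and free algebras -/

/-- A variety in the signature `L`, i.e. the class of all algebras satisfying
a given set of identities `s ≈ t` (in the variables `x₀, x₁, …`). -/
structure Variety (L : FirstOrder.Language.{u, v}) where
  identities : Set (L.Term ℕ × L.Term ℕ)

namespace Variety

variable {L : FirstOrder.Language.{u, v}}

/-- The algebra `A` belongs to the variety. -/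
def Mem (V : Variety L) (A : Type w) [L.Structure A] : Prop :=
  ∀ e ∈ V.identities, ∀ x : ℕ → A, e.1.realize x = e.2.realize x

/-- The identity `s ≈ t` is true in the variety. -/
def Satisfies (V : Variety L) {α : Type} (s t : L.Term α) : Prop :=
  ∀ (A : Type u) [L.Structure A] [Nonempty A], V.Mem A →
    ∀ x : α → A, s.realize x = t.realize x

/-- The term algebra. -/
instance termAlgebra [L.IsAlgebraic] (α : Type) : L.Structure (L.Term α) where
  funMap f ts := Term.func f ts
  RelMap r := isEmptyElim r

/-- The congruence of the term algebra consisting of the identities true in `V`. -/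
def freeCongruence [L.IsAlgebraic] (V : Variety L) (α : Type) : Congruence L (L.Term α) where
  r s t := V.Satisfies s t
  iseqv := ⟨fun _ _ _ _ _ _ => rfl, fun h A _ _ hA x => (h A hA x).symm,
    fun h₁ h₂ A _ _ hA x => (h₁ A hA x).trans (h₂ A hA x)⟩
  compat := fun f _ _ h A _ _ hA x =>
    congrArg (Structure.funMap f) (funext fun i => h i A hA x)

/-- The `V`-free algebra freely generated by `α`. -/
abbrev Free [L.IsAlgebraic] (V : Variety L) (α : Type) : Type u := (V.freeCongruence α).Quot

/-- The free generators. -/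
def gen [L.IsAlgebraic] (V : Variety L) {α : Type} (i : α) : V.Free α :=
  Quotient.mk _ (Term.var i)

/-- The ternary term `t` is idempotent in `V`: `V ⊨ t(x,x,x) ≈ x`. -/
def IsIdempotent (V : Variety L) (t : L.Term (Fin 3)) : Prop :=
  V.Satisfies (t.subst fun _ => Term.var (0 : Fin 1)) (Term.var 0)

end Variety

/-! ### Weak difference terms -/

/-- `d` is a weak difference term for the algebra `A`: `d` is idempotent and, for all congruences
`δ ≤ θ` with `θ/δ` abelian and all `(a, b) ∈ θ`, `d(a,a,b) ≡ b ≡ d(b,a,a)` modulo `δ`. -/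
def IsWeakDifferenceTermFor {L : FirstOrder.Language.{u, v}} [L.IsAlgebraic] (d : L.Term (Fin 3))
    (A : Type w) [L.Structure A] : Prop :=
  (∀ a : A, d.realize ![a, a, a] = a) ∧
  ∀ (δ θ : Congruence L A) (hle : δ ≤ θ), (θ.modulo δ hle).IsAbelian →
    ∀ a b : A, θ.Rel a b →
      δ.Rel (d.realize ![a, a, b]) b ∧ δ.Rel b (d.realize ![b, a, a])

/-- `d` is a weak difference term for the variety `V`. -/
def Variety.IsWeakDifferenceTerm {L : FirstOrder.Language.{u, v}} [L.IsAlgebraic] (V : Variety L)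
    (d : L.Term (Fin 3)) : Prop :=
  ∀ (A : Type u) [L.Structure A] [Nonempty A], V.Mem A → IsWeakDifferenceTermFor d A

/-! ### The abstract identities -/

/-- The ternary operation symbols `d, f₁, f₂, …` (here `f i` stands for `f_{i+1}`). -/
inductive TernarySymbol : ℕ → Type
  | d : TernarySymbol 3
  | f (i : ℕ) : TernarySymbol 3

/-- The signature with the ternary operation symbols `d, f₁, f₂, …`. -/
def ternaryLanguage : FirstOrder.Language.{0, 0} := ⟨TernarySymbol, fun _ => Empty⟩

/-- The interpretation of the symbols `d, f₁, f₂, …` by ternary terms of the signature `L`. -/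
def interpretSymbol {L : FirstOrder.Language.{u, v}} (d : L.Term (Fin 3)) (f : ℕ → L.Term (Fin 3)) :
    ∀ {n : ℕ}, ternaryLanguage.Functions n → L.Term (Fin n)
  | _, TernarySymbol.d => d
  | _, TernarySymbol.f i => f i

/-- An identity in the symbols `d, f₁, f₂, …` and the variables `x, y` (indexed by `Fin 2`). -/
abbrev TernaryIdentity : Type := ternaryLanguage.Term (Fin 2) × ternaryLanguage.Term (Fin 2)

/-- The identity `e` is true in `V` when `d, f₁, f₂, …` are interpreted by the given terms. -/
def Variety.SatisfiesInterpreted {L : FirstOrder.Language.{u, v}} (V : Variety L) (d : L.Term (Fin 3))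
    (f : ℕ → L.Term (Fin 3)) (e : TernaryIdentity) : Prop :=
  V.Satisfies (e.1.substFunc (interpretSymbol d f)) (e.2.substFunc (interpretSymbol d f))

/-! ### The condition in the free algebra on three generators -/

/-- In `F = F_V(3)`, freely generated by `x, y, z`, with `α = Cg(x,z)`, `β = Cg(x,y)`,
`γ = Cg(y,z)`: the pair `(β_m, γ_m)`. -/
def Variety.freeBetaGamma {L : FirstOrder.Language.{u, v}} [L.IsAlgebraic] (V : Variety L) (m : ℕ) :
    Congruence L (V.Free (Fin 3)) × Congruence L (V.Free (Fin 3)) :=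
  Congruence.betaGamma (Congruence.cg L (V.gen (0 : Fin 3)) (V.gen 2))
    (Congruence.cg L (V.gen (0 : Fin 3)) (V.gen 1))
    (Congruence.cg L (V.gen (1 : Fin 3)) (V.gen 2)) m

/-- The element `d^F(x, y, z)` of `F = F_V(3)`. -/
def Variety.freeElement {L : FirstOrder.Language.{u, v}} [L.IsAlgebraic] (V : Variety L)
    (d : L.Term (Fin 3)) : V.Free (Fin 3) :=
  d.realize ![V.gen 0, V.gen 1, V.gen 2]

end UnivAlg

/-!
Write `x, y, z` for the free generators and `d` for `d(x, y, z)`. The three conditions (weak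
difference term, chain in the free algebra, identities) are shown to imply each other cyclically.

From a weak difference term to a chain. In the free algebra put `δ = α ∧ ⋃ βₙ`, which equals `α ∧
⋃ γₙ`. Both unions contain `δ` and meet `α` in `δ`, so both centralize `α` modulo `δ`, and hence
so does their join, which contains `α`. Thus `α/δ` is abelian
(`exists_isAbelian_modulo_betaGamma`), and a weak difference term satisfies `d(x,y,z) β d(x,x,z) δ
z` and `x δ d(x,z,z) γ d(x,y,z)`.

From a chain to identities. Joins of congruences are transitive closures of unions, so `(x, d) ∈
γₘ` and `(d, z) ∈ βₘ` are witnessed by finitely many links of the congruences `α`, `β`, `γ`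
between elements of the free algebra (`Linked`). A link of one of these congruences is an identity
between two ternary terms in which two of the three variables have been identified. The sets `Sig
n` enumerate all finite sets of formal links from which a chain from `x` through `d` to `z` can be
derived; since links preserve idempotence, the terms that occur are idempotent.

From identities to a weak difference term. After passing to a quotient algebra, let `θ` be
abelian. Along a chain one shows by induction that nodes `p`, `q` linked by `βₙ` satisfy `p(a,a,b)
= q(a,a,b)`, and those linked by `γₙ` satisfy `p(a,b,b) = q(a,b,b)`, for `(a, b) ∈ θ`. In the
inductive step two matrices of `θ` have three corners in common, and the point is that they then
share the fourth (`eq_of_isMatrix`). Suppose that the fourth corners `u` and `v` differ, and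
compose all nodes into a single idempotent term `T` with distinct variables at the leaves. Then
`T(u, …, u) ≠ T(v, …, v)`, so some variable `σ` of `T` distinguishes `u` from `v`; each node is
obtained from `T` by identifying variables, which turns `σ` into one of the three variables of the
node. Applying `T` to the given matrices, the term condition shows that every identity in two
variables between nodes remains true when each node is replaced by its projection to that variable
(`projection_satisfies`). But no projection can be linked both to `x` by the `γ`-chain and to `z`
by the `β`-chain.
-/

/-! ### Congruences: joins, directed unions, centralizers -/

namespace UnivAlg

open FirstOrder FirstOrder.Language

/-- A preorder on tuples that contains every change of a single coordinate along `P` contains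
every change of all coordinates along `P`. -/
theorem rel_of_update {ι : Type*} {A : Type*} [Finite ι] [DecidableEq ι] {P : A → A → Prop}
    {R : (ι → A) → (ι → A) → Prop} (hrefl : ∀ a, R a a)
    (htrans : ∀ a b c, R a b → R b c → R a c)
    (hstep : ∀ a i x y, P x y → R (Function.update a i x) (Function.update a i y))
    {a b : ι → A} (h : ∀ i, P (a i) (b i)) : R a b := by
  classical
  cases nonempty_fintype ι
  have key : ∀ s : Finset ι, R a (s.piecewise b a) := by
    intro s
    induction s using Finset.induction_on with
    | empty => simpa using hrefl a
    | insert j s hj ih =>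
      refine htrans _ _ _ ih ?_
      have h1 := hstep (s.piecewise b a) j (a j) (b j) (h j)
      rw [Finset.piecewise_insert]
      convert h1 using 1
      rw [eq_comm, Function.update_eq_self_iff]
      simp [hj]
  simpa using key Finset.univ

namespace Congruence

variable {L : FirstOrder.Language.{u, v}} {A : Type w} [L.Structure A]

theorem realize_rel (θ : Congruence L A) {ι : Type*} (t : L.Term ι) {a b : ι → A}
    (h : ∀ i, θ.Rel (a i) (b i)) : θ.Rel (t.realize a) (t.realize b) := by
  induction t with
  | var i => exact h i
  | func f ts ih => exact θ.compat f _ _ ih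

theorem rel_update (θ : Congruence L A) {ι : Type*} [DecidableEq ι] (a : ι → A) (i : ι) {x y : A}
    (h : θ.Rel x y) (j : ι) : θ.Rel (Function.update a i x j) (Function.update a i y j) := by
  by_cases hj : j = i
  · subst hj; simpa using h
  · rw [Function.update_of_ne hj, Function.update_of_ne hj]
    exact θ.refl' (a j)

/-- The join of two congruences is the transitive closure of their union, stated as an induction
principle. -/
theorem sup_induction {φ ψ : Congruence L A} {E : A → A → Prop} (hrefl : ∀ a, E a a)
    (htrans : ∀ a b c, E a b → E b c → E a c) (hφ : ∀ a b, φ.Rel a b → E a b)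
    (hψ : ∀ a b, ψ.Rel a b → E a b) {a b : A} (h : (φ ⊔ ψ).Rel a b) : E a b := by
  let R : A → A → Prop := Relation.ReflTransGen fun a b => φ.Rel a b ∨ ψ.Rel a b
  have hsymm : ∀ {a b}, R a b → R b a := by
    intro a b hab
    induction hab with
    | refl => exact .refl
    | tail _ h ih => exact .head (h.imp (fun h => φ.symm' h) (fun h => ψ.symm' h)) ih
  let κ : Congruence L A :=
    { r := R
      iseqv := ⟨fun _ => .refl, hsymm, fun h₁ h₂ => Relation.ReflTransGen.trans h₁ h₂⟩
      compat := by
        intro n f x y hxy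
        refine rel_of_update (P := R) (R := fun x y => R (Structure.funMap f x)
          (Structure.funMap f y)) (fun _ => .refl)
          (fun _ _ _ h₁ h₂ => Relation.ReflTransGen.trans h₁ h₂) ?_ hxy
        intro c i p q hpq
        refine Relation.ReflTransGen.lift (fun t => Structure.funMap f (Function.update c i t))
          (fun p q h => ?_) _ _ hpq
        exact h.imp (fun h => φ.compat f _ _ (φ.rel_update c i h))
          (fun h => ψ.compat f _ _ (ψ.rel_update c i h)) }
  have hle : φ ⊔ ψ ≤ κ :=
    sup_le (fun _ _ h => .single (.inl h)) (fun _ _ h => .single (.inr h))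
  have hab : R a b := hle a b h
  clear h
  induction hab with
  | refl => exact hrefl _
  | tail _ h ih => exact htrans _ _ _ ih (h.elim (hφ _ _) (hψ _ _))

/-- The union of an increasing sequence of congruences. -/
def iUnion (θ : ℕ → Congruence L A) (hθ : Monotone θ) : Congruence L A where
  r a b := ∃ n, (θ n).Rel a b
  iseqv := by
    refine ⟨fun a => ⟨0, (θ 0).refl' a⟩, fun ⟨n, h⟩ => ⟨n, (θ n).symm' h⟩, ?_⟩
    rintro a b c ⟨m, h₁⟩ ⟨n, h₂⟩
    exact ⟨max m n, (θ _).trans' (hθ (le_max_left m n) _ _ h₁) (hθ (le_max_right m n) _ _ h₂)⟩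
  compat := by
    intro k f x y h
    choose n hn using h
    exact ⟨Finset.univ.sup n, (θ _).compat f x y fun i =>
      hθ (Finset.le_sup (Finset.mem_univ i)) _ _ (hn i)⟩

theorem cg_rel (a b : A) : (cg L a b).Rel a b := fun _ h => h

theorem cg_le {a b : A} {θ : Congruence L A} (h : θ.Rel a b) : cg L a b ≤ θ := sInf_le h

theorem Centralizes.mono_left {φ φ' θ δ : Congruence L A} (h : Centralizes φ θ δ) (hle : φ' ≤ φ) :
    Centralizes φ' θ δ :=
  fun m n t a b c d hab hcd => h m n t a b c d (fun i => hle _ _ (hab i)) hcd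

/-- The term condition for terms in arbitrary, possibly infinite, sets of variables. -/
theorem Centralizes.realize {φ θ δ : Congruence L A} (h : Centralizes φ θ δ) {X Y : Type*}
    (t : L.Term (X ⊕ Y)) {a b : X → A} {c d : Y → A} (hab : ∀ i, φ.Rel (a i) (b i))
    (hcd : ∀ j, θ.Rel (c j) (d j))
    (ht : δ.Rel (t.realize (Sum.elim a c)) (t.realize (Sum.elim a d))) :
    δ.Rel (t.realize (Sum.elim b c)) (t.realize (Sum.elim b d)) := by
  classical
  let eX := t.varFinset.toLeft.equivFin
  let eY := t.varFinset.toRight.equivFin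
  let g : t.varFinset → Fin t.varFinset.toLeft.card ⊕ Fin t.varFinset.toRight.card := fun
    | ⟨.inl x, hx⟩ => .inl (eX ⟨x, Finset.mem_toLeft.2 hx⟩)
    | ⟨.inr y, hy⟩ => .inr (eY ⟨y, Finset.mem_toRight.2 hy⟩)
  have key : ∀ (p : X → A) (q : Y → A), (t.restrictVar g).realize
      (Sum.elim (fun i => p (eX.symm i)) (fun j => q (eY.symm j))) =
      t.realize (Sum.elim p q) := by
    intro p q
    refine Term.realize_restrictVar _ ?_
    rintro ⟨x | y, hx⟩ <;> simp [g]
  have := h _ _ (t.restrictVar g) (fun i => a (eX.symm i)) (fun i => b (eX.symm i))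
    (fun j => c (eY.symm j)) (fun j => d (eY.symm j)) (fun i => hab _) (fun j => hcd _)
  rw [key, key, key, key] at this
  exact this ht

theorem centralizes_of_inf_le {φ θ δ : Congruence L A} (h₁ : δ ≤ φ) (h₂ : θ ⊓ φ ≤ δ) :
    Centralizes φ θ δ := by
  intro m n t a b c d hab hcd h
  refine h₂ _ _ ⟨θ.realize_rel t ?_, ?_⟩
  · rintro (i | j)
    exacts [θ.refl' _, hcd j]
  · have hφ : ∀ e : Fin n → A,
        φ.Rel (t.realize (Sum.elim a e)) (t.realize (Sum.elim b e)) := by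
      intro e
      refine φ.realize_rel t ?_
      rintro (i | j)
      exacts [hab i, φ.refl' _]
    exact φ.trans' (φ.symm' (hφ c)) (φ.trans' (h₁ _ _ h) (hφ d))

theorem Centralizes.sup {φ ψ θ δ : Congruence L A} (hφ : Centralizes φ θ δ)
    (hψ : Centralizes ψ θ δ) : Centralizes (φ ⊔ ψ) θ δ := by
  intro m n t a b c d hab hcd
  refine rel_of_update (P := (φ ⊔ ψ).Rel)
    (R := fun a b => δ.Rel (t.realize (Sum.elim a c)) (t.realize (Sum.elim a d)) →
      δ.Rel (t.realize (Sum.elim b c)) (t.realize (Sum.elim b d)))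
    (fun _ h => h) (fun _ _ _ h₁ h₂ h => h₂ (h₁ h)) ?_ hab
  intro e i x y hxy
  refine sup_induction (E := fun x y =>
    δ.Rel (t.realize (Sum.elim (Function.update e i x) c))
      (t.realize (Sum.elim (Function.update e i x) d)) →
    δ.Rel (t.realize (Sum.elim (Function.update e i y) c))
      (t.realize (Sum.elim (Function.update e i y) d)))
    (fun _ h => h) (fun _ _ _ h₁ h₂ h => h₂ (h₁ h)) ?_ ?_ hxy
  · exact fun x y h => hφ m n t _ _ c d (φ.rel_update e i h) hcd
  · exact fun x y h => hψ m n t _ _ c d (ψ.rel_update e i h) hcd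

theorem Centralizes.isAbelian_modulo [L.IsAlgebraic] {θ δ : Congruence L A}
    (h : Centralizes θ θ δ) (hle : δ ≤ θ) : (θ.modulo δ hle).IsAbelian := by
  intro m n t a b c d hab hcd ht
  choose a' b' ha hb hab' using hab
  choose c' d' hc hd hcd' using hcd
  obtain rfl := funext ha
  obtain rfl := funext hb
  obtain rfl := funext hc
  obtain rfl := funext hd
  have key : ∀ (p : Fin m → A) (q : Fin n → A),
      t.realize (Sum.elim (fun i => (Quotient.mk δ.toSetoid (p i)))
        (fun j => Quotient.mk δ.toSetoid (q j))) =
      Quotient.mk δ.toSetoid (t.realize (Sum.elim p q)) := by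
    intro p q
    rw [← Term.realize_quotient_mk']
    congr 1
    funext i
    cases i <;> rfl
  have ht' := ht
  change t.realize _ = t.realize _ at ht'
  change t.realize _ = t.realize _
  rw [key, key] at ht' ⊢
  exact Quotient.sound (h m n t a' b' c' d' hab' hcd' (Quotient.exact ht'))

theorem betaGamma_le_succ (α β γ : Congruence L A) (n : ℕ) :
    betaGamma α β γ n ≤ betaGamma α β γ (n + 1) := by
  induction n with
  | zero => exact ⟨le_sup_left, le_sup_left⟩
  | succ n ih =>
    exact ⟨sup_le_sup_left (inf_le_inf_left _ ih.2) _, sup_le_sup_left (inf_le_inf_left _ ih.1) _⟩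

theorem betaGamma_mono (α β γ : Congruence L A) : Monotone (betaGamma α β γ) :=
  monotone_nat_of_le_succ (betaGamma_le_succ α β γ)

/-- If `α ≤ β ∨ γ`, then `α` is abelian over `δ = α ∧ ⋃ βₙ = α ∧ ⋃ γₙ`: both unions centralize `α`
modulo `δ`, hence so does their join. -/
theorem exists_isAbelian_modulo_betaGamma [L.IsAlgebraic] {α β γ : Congruence L A}
    (h : α ≤ β ⊔ γ) :
    ∃ (δ : Congruence L A) (hle : δ ≤ α), (α.modulo δ hle).IsAbelian ∧
      ∀ a b, δ.Rel a b →
        ∃ n, (betaGamma α β γ n).1.Rel a b ∧ (betaGamma α β γ n).2.Rel a b := by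
  have hm := betaGamma_mono α β γ
  let B := iUnion (fun n => (betaGamma α β γ n).1) fun _ _ h => (hm h).1
  let C := iUnion (fun n => (betaGamma α β γ n).2) fun _ _ h => (hm h).2
  have hBC : α ⊓ B ≤ C := by
    rintro a b ⟨h₁, n, h₂⟩
    exact ⟨n + 1, (le_sup_right : _ ≤ γ ⊔ _) _ _ ⟨h₁, h₂⟩⟩
  have hCB : α ⊓ C ≤ α ⊓ B := by
    rintro a b ⟨h₁, n, h₂⟩
    exact ⟨h₁, n + 1, (le_sup_right : _ ≤ β ⊔ _) _ _ ⟨h₁, h₂⟩⟩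
  have hα : α ≤ B ⊔ C := h.trans (sup_le_sup (fun _ _ h => ⟨0, h⟩) (fun _ _ h => ⟨0, h⟩))
  refine ⟨α ⊓ B, inf_le_left, Centralizes.isAbelian_modulo ?_ _, ?_⟩
  · exact ((centralizes_of_inf_le inf_le_right le_rfl).sup
      (centralizes_of_inf_le hBC hCB)).mono_left hα
  · rintro a b hab
    obtain ⟨m, hb⟩ := hab.2
    obtain ⟨n, hc⟩ := hBC _ _ hab
    exact ⟨max m n, (hm (le_max_left m n)).1 _ _ hb, (hm (le_max_right m n)).2 _ _ hc⟩

end Congruence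

end UnivAlg

/-! ### Matrices of a pair of congruences -/

namespace UnivAlg

open FirstOrder FirstOrder.Language

namespace Congruence

variable {L : FirstOrder.Language.{u, v}} {A : Type w} [L.Structure A]

/-- `θ.IsMatrix p q r s` says that the `2 × 2` matrix with rows `(p, q)` and `(r, s)` is of the form
`t(a, c), t(a, d); t(b, c), t(b, d)` for a term `t` and `θ`-related tuples `a, b` and `c, d`.
The variables of `t` are indexed by the elements of `θ`, so that all matrices use the same tuples
and applying a term to matrices gives a matrix. -/
def IsMatrix (θ : Congruence L A) (p q r s : A) : Prop :=
  ∃ t : L.Term ({x : A × A // θ.Rel x.1 x.2} ⊕ {x : A × A // θ.Rel x.1 x.2}),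
    t.realize (Sum.elim (fun x => x.1.1) (fun x => x.1.1)) = p ∧
    t.realize (Sum.elim (fun x => x.1.1) (fun x => x.1.2)) = q ∧
    t.realize (Sum.elim (fun x => x.1.2) (fun x => x.1.1)) = r ∧
    t.realize (Sum.elim (fun x => x.1.2) (fun x => x.1.2)) = s

namespace IsMatrix

variable {θ : Congruence L A} {p q r s : A}

theorem of_term {X Y : Type*} (t : L.Term (X ⊕ Y)) {a b : X → A} {c d : Y → A}
    (hab : ∀ i, θ.Rel (a i) (b i)) (hcd : ∀ j, θ.Rel (c j) (d j)) :
    θ.IsMatrix (t.realize (Sum.elim a c)) (t.realize (Sum.elim a d))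
      (t.realize (Sum.elim b c)) (t.realize (Sum.elim b d)) := by
  refine ⟨t.relabel (Sum.map (fun i => ⟨(a i, b i), hab i⟩) (fun j => ⟨(c j, d j), hcd j⟩)),
    ?_, ?_, ?_, ?_⟩ <;>
  · rw [Term.realize_relabel, Sum.elim_comp_map]
    rfl

theorem const_rows {a b : A} (h : θ.Rel a b) : θ.IsMatrix a a b b :=
  of_term (Term.var (.inl ()) : L.Term (Unit ⊕ Unit)) (a := fun _ => a) (b := fun _ => b)
    (c := fun _ => a) (d := fun _ => a) (fun _ => h) (fun _ => θ.refl' a)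

theorem swap_columns (h : θ.IsMatrix p q r s) : θ.IsMatrix q p s r := by
  obtain ⟨t, rfl, rfl, rfl, rfl⟩ := h
  exact of_term t (fun x => x.2) (fun x => θ.symm' x.2)

theorem rel_row (h : θ.IsMatrix p q r s) : θ.Rel p q := by
  obtain ⟨t, rfl, rfl, rfl, rfl⟩ := h
  refine θ.realize_rel t ?_
  rintro (x | x)
  exacts [θ.refl' _, x.2]

theorem rel_column (h : θ.IsMatrix p q r s) : θ.Rel p r := by
  obtain ⟨t, rfl, rfl, rfl, rfl⟩ := h
  refine θ.realize_rel t ?_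
  rintro (x | x)
  exacts [x.2, θ.refl' _]

theorem realize {ι : Type*} (t : L.Term ι) {p q r s : ι → A}
    (h : ∀ i, θ.IsMatrix (p i) (q i) (r i) (s i)) :
    θ.IsMatrix (t.realize p) (t.realize q) (t.realize r) (t.realize s) := by
  choose t' hp hq hr hs using h
  refine ⟨t.subst t', ?_, ?_, ?_, ?_⟩ <;>
    simp only [Term.realize_subst, hp, hq, hr, hs]

theorem eq_of_isAbelian (hθ : θ.IsAbelian) (h : θ.IsMatrix p q r s) (hrs : r = s) : p = q := by
  obtain ⟨t, rfl, rfl, rfl, rfl⟩ := h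
  exact Centralizes.realize hθ t (fun x => θ.symm' x.2) (fun x => x.2) hrs

end IsMatrix

end Congruence

/-! ### Composing finitely many terms into one -/

variable {L : FirstOrder.Language.{u, v}} {A : Type w} [L.Structure A] {κ : Type}

/-- The composite `f₀(f₁(⋯), …, f₁(⋯))` of finitely many terms in the variables `κ`, with pairwise
distinct variables at the leaves. A leaf is given by the branch taken at each level. -/
def composite : ∀ {k : ℕ}, (Fin k → L.Term κ) → L.Term (Fin k → κ)
  | 0, _ => Term.var fun i => i.elim0
  | _ + 1, f => (f 0).subst fun i =>
      (composite fun j => f j.succ).relabel (Fin.cons (α := fun _ => κ) i)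

theorem realize_composite_const {k : ℕ} {f : Fin k → L.Term κ}
    (hf : ∀ i (a : A), (f i).realize (fun _ => a) = a) (a : A) :
    (composite f).realize (fun _ => a) = a := by
  induction k with
  | zero => rfl
  | succ k ih =>
    simp only [composite, Term.realize_subst, Term.realize_relabel, Function.comp_def]
    rw [ih fun i => hf i.succ]
    exact hf 0 a

/-- Each factor is recovered from the composite by identifying all leaves that take the same branch
at the level of that factor. -/
theorem realize_composite_apply {k : ℕ} {f : Fin k → L.Term κ}
    (hf : ∀ i (a : A), (f i).realize (fun _ => a) = a) (i : Fin k) (y : κ → A) :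
    (composite f).realize (fun s => y (s i)) = (f i).realize y := by
  induction k with
  | zero => exact i.elim0
  | succ k ih =>
    simp only [composite, Term.realize_subst, Term.realize_relabel, Function.comp_def]
    refine Fin.cases ?_ (fun i => ?_) i
    · simp only [Fin.cons_zero]
      congr 1
      funext j
      exact realize_composite_const (fun i => hf i.succ) _
    · simp only [Fin.cons_succ]
      rw [ih fun i => hf i.succ]
      exact hf 0 _

/-! ### The fourth corner of a matrix -/

open Function Congruence

/-- If `T(u, …, u) ≠ T(v, …, v)`, then some variable of `T` distinguishes `u` from `v`. -/
theorem exists_update_ne {ι : Type*} [Finite ι] [DecidableEq ι] {θ : Congruence L A} (T : L.Term ι)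
    {u v : A} (huv : θ.Rel u v) (hne : T.realize (fun _ => u) ≠ T.realize (fun _ => v)) :
    ∃ (σ : ι) (c : ι → A), (∀ s, θ.Rel u (c s)) ∧
      T.realize (update c σ u) ≠ T.realize (update c σ v) := by
  by_contra! hcon
  refine hne ?_
  have key := rel_of_update (P := fun x y => x = u ∧ y = v)
    (R := fun a b => (∀ s, θ.Rel u (a s)) →
      (∀ s, θ.Rel u (b s)) ∧ T.realize a = T.realize b)
    (fun a h => ⟨h, rfl⟩)
    (fun a b c h₁ h₂ h => ⟨(h₂ (h₁ h).1).1, (h₁ h).2.trans (h₂ (h₁ h).1).2⟩) ?_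
    (a := fun _ : ι => u) (b := fun _ => v) (fun _ => ⟨rfl, rfl⟩)
  · exact (key fun _ => θ.refl' u).2
  · rintro a i _ _ ⟨rfl, rfl⟩ h
    refine ⟨fun s => θ.trans' (h s) (θ.rel_update a i huv s), ?_⟩
    simpa using hcon i _ h

/-- Over an abelian congruence, whether a variable of `T` distinguishes `u` from `v` does not depend
on the values of the other variables. -/
theorem realize_update_eq {ι : Type*} [DecidableEq ι] {θ : Congruence L A}
    (hθ : θ.IsAbelian) (T : L.Term ι) {u v : A} (huv : θ.Rel u v) (σ : ι) {g c : ι → A}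
    (hgc : ∀ s, θ.Rel (g s) (c s))
    (h : T.realize (update g σ u) = T.realize (update g σ v)) :
    T.realize (update c σ u) = T.realize (update c σ v) := by
  have key : ∀ (e : ι → A) (x : A), (T.relabel fun s => if s = σ then Sum.inr () else Sum.inl s :
      L.Term (ι ⊕ Unit)).realize (Sum.elim e fun _ => x) = T.realize (update e σ x) := by
    intro e x
    rw [Term.realize_relabel]
    congr 1
    funext s
    by_cases hs : s = σ
    · subst hs; simp
    · simp [hs]
  have := Centralizes.realize hθ (T.relabel fun s => if s = σ then Sum.inr () else Sum.inl s :
      L.Term (ι ⊕ Unit)) (c := fun _ => u) (d := fun _ => v) hgc (fun _ => huv)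
  rw [key, key, key, key] at this
  exact this h

/-- Suppose that two matrices of an abelian congruence agree except that one has `u` and the other
has `v` in the upper right corner. If a variable `σ` of the composite of the idempotent terms `f`
distinguishes `u` from `v`, then every two-variable identity between the terms `f` remains true when
`f i` is replaced by the projection to the variable `σ i`. -/
theorem projection_satisfies {k : ℕ} {θ : Congruence L A} (hθ : θ.IsAbelian) {f : Fin k → L.Term κ}
    (hf : ∀ i (a : A), (f i).realize (fun _ => a) = a) {e u v a b : A}
    (hu : θ.IsMatrix e u a b) (hv : θ.IsMatrix e v a b) [DecidableEq (Fin k → κ)]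
    {σ : Fin k → κ} {c : (Fin k → κ) → A} (hc : ∀ s, θ.Rel u (c s))
    (hne : (composite f).realize (update c σ u) ≠ (composite f).realize (update c σ v))
    {i j : Fin k} {π π' : κ → Fin 2}
    (hid : ∀ y : Fin 2 → A, (f i).realize (y ∘ π) = (f j).realize (y ∘ π')) :
    π (σ i) = π' (σ j) := by
  have huv : θ.Rel u v := θ.trans' (θ.symm' hu.rel_row) hv.rel_row
  let top : Fin 2 → A := ![e, u]
  let bot : Fin 2 → A := ![a, b]
  have hM : ∀ k l, θ.IsMatrix (top k) (top l) (bot k) (bot l) := by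
    intro k l
    fin_cases k <;> fin_cases l
    · exact IsMatrix.const_rows hu.rel_column
    · exact hu
    · exact hu.swap_columns
    · exact IsMatrix.const_rows hu.swap_columns.rel_column
  have htop : ∀ k, θ.Rel (top k) u := by
    intro k
    fin_cases k
    · exact hu.rel_row
    · exact θ.refl' u
  -- Apply the composite to matrices with equal bottom rows: the value of the top row at the
  -- variable `σ` may be `u` or `v`.
  have key : ∀ {i j : Fin k} {π π' : κ → Fin 2},
      (∀ y : Fin 2 → A, (f i).realize (y ∘ π) = (f j).realize (y ∘ π')) →
      ¬ (π (σ i) = 1 ∧ π' (σ j) = 0) := by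
    rintro i j π π' hid ⟨hi, hj⟩
    have hbot : (composite f).realize (fun s => bot (π (s i))) =
        (composite f).realize (fun s => bot (π' (s j))) :=
      (realize_composite_apply hf i (bot ∘ π)).trans
        ((hid bot).trans (realize_composite_apply hf j (bot ∘ π')).symm)
    have h₁ := (IsMatrix.realize (composite f)
      fun s => hM (π (s i)) (π' (s j))).eq_of_isAbelian hθ hbot
    have h₂ := (IsMatrix.realize (composite f)
      (p := update (fun s => top (π (s i))) σ v)
      (q := fun s => top (π' (s j))) (fun s => ?_)).eq_of_isAbelian hθ hbot
    · refine hne (realize_update_eq hθ _ huv σ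
        (fun s => θ.trans' (htop (π (s i))) (hc s)) (h := ?_))
      rw [h₂, ← h₁]
      congr 1
      rw [update_eq_self_iff]
      simp [hi, top]
    · by_cases hs : s = σ
      · subst hs
        simpa [hi, hj, top, bot] using hv.swap_columns
      · simpa [hs] using hM (π (s i)) (π' (s j))
  have h₁ := key hid
  have h₂ := key fun y => (hid y).symm
  grind

end UnivAlg

namespace UnivAlg

open FirstOrder FirstOrder.Language Congruence

/-! ### Free algebras and evaluation -/

namespace Variety

variable {L : FirstOrder.Language.{u, v}} [L.IsAlgebraic] {V : Variety L}

theorem Mem.quot {A : Type w} [L.Structure A] (hA : V.Mem A) (δ : Congruence L A) :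
    V.Mem δ.Quot := by
  intro e he x
  obtain ⟨y, rfl⟩ : ∃ y : ℕ → A, (fun i => Quotient.mk δ.toSetoid (y i)) = x :=
    ⟨fun i => (x i).out, funext fun i => (x i).out_eq⟩
  rw [Term.realize_quotient_mk', Term.realize_quotient_mk', hA e he]

theorem realize_termAlgebra {α β : Type} (t : L.Term α) (p : α → L.Term β) :
    t.realize p = t.subst p := by
  induction t with
  | var => rfl
  | func f ts ih => exact congrArg (Term.func f) (funext ih)

theorem mem_free (V : Variety L) (α : Type) : V.Mem (V.Free α) := by
  intro e he x
  obtain ⟨p, rfl⟩ : ∃ p : ℕ → L.Term α,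
      (fun i => Quotient.mk (V.freeCongruence α).toSetoid (p i)) = x :=
    ⟨fun i => (x i).out, funext fun i => (x i).out_eq⟩
  rw [Term.realize_quotient_mk', Term.realize_quotient_mk']
  refine Quotient.sound fun A _ _ hA y => ?_
  rw [realize_termAlgebra, realize_termAlgebra, Term.realize_subst, Term.realize_subst, hA e he]

theorem realize_gen (V : Variety L) {α : Type} (t : L.Term α) :
    t.realize (fun i => V.gen i) = Quotient.mk (V.freeCongruence α).toSetoid t := by
  refine (Term.realize_quotient_mk' (V.freeCongruence α).toSetoid t Term.var).trans ?_
  congr 1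
  rw [realize_termAlgebra]
  induction t with
  | var => rfl
  | func f ts ih => exact congrArg (Term.func f) (funext ih)

/-- The homomorphism from the free algebra to `A` that extends an assignment of the generators. -/
def eval {α : Type} {A : Type u} [L.Structure A] [Nonempty A] (hA : V.Mem A) (y : α → A) :
    V.Free α → A :=
  Quotient.lift (fun t => t.realize y) fun _ _ h => h A hA y

/-- The kernel of `eval`. -/
def evalKer {α : Type} {A : Type u} [L.Structure A] [Nonempty A] (hA : V.Mem A) (y : α → A) :
    Congruence L (V.Free α) where
  r P Q := eval hA y P = eval hA y Q
  iseqv := ⟨fun _ => rfl, Eq.symm, Eq.trans⟩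
  compat := by
    have key : ∀ {n : ℕ} (f : L.Functions n) (P : Fin n → V.Free α),
        eval hA y (Structure.funMap f P) = Structure.funMap f fun i => eval hA y (P i) := by
      intro n f P
      obtain ⟨p, rfl⟩ : ∃ p : Fin n → L.Term α,
          (fun i => Quotient.mk (V.freeCongruence α).toSetoid (p i)) = P :=
        ⟨fun i => (P i).out, funext fun i => (P i).out_eq⟩
      rw [funMap_quotient_mk']
      rfl
    intro n f P Q h
    rw [key, key, funext h]

/-- The idempotent elements of the free algebra. -/
def Idempotent {α : Type} (P : V.Free α) : Prop :=
  ∀ (A : Type u) [L.Structure A] [Nonempty A] (hA : V.Mem A) (a : A), eval hA (fun _ => a) P = a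

theorem isIdempotent_of_idempotent {t : L.Term (Fin 3)}
    (h : Idempotent (Quotient.mk (V.freeCongruence (Fin 3)).toSetoid t)) : V.IsIdempotent t := by
  intro A _ _ hA x
  rw [Term.realize_subst]
  exact h A hA (x 0)

end Variety

/-! ### Chains of links -/

/-- The three ways of identifying two of the variables `x₀, x₁, x₂`: `none` identifies `x₀` and
`x₂`, `some true` identifies `x₀` and `x₁`, and `some false` identifies `x₁` and `x₂`; they
correspond to the congruences `α`, `β` and `γ`. -/
def collapse : Option Bool → Fin 3 → Fin 2
  | none => ![0, 1, 0]
  | some true => ![0, 0, 1]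
  | some false => ![0, 1, 1]

/-- `S` is a set of links `(k, p, q)`, read as "`p` and `q` are related by the `k`-th of `α, β, γ`".
`Linked S true p q` and `Linked S false p q` say that these links suffice to
derive that `p` and `q` are related by some `βₙ`, respectively by some `γₙ`. -/
inductive Linked {N : Type*} (S : Set (Option Bool × N × N)) : Bool → N → N → Prop
  | refl (b : Bool) (p : N) : Linked S b p p
  | trans {b : Bool} {p q r : N} : Linked S b p q → Linked S b q r → Linked S b p r
  | base {b : Bool} {p q : N} : (some b, p, q) ∈ S → Linked S b p q
  | step {b : Bool} {p q : N} : (none, p, q) ∈ S → Linked S (!b) p q → Linked S b p q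

namespace Linked

variable {N N' : Type*} {S : Set (Option Bool × N × N)} {b : Bool} {p q : N}

theorem map {S' : Set (Option Bool × N' × N')} (ν : N → N')
    (hS : ∀ k p q, (k, p, q) ∈ S → (k, ν p, ν q) ∈ S') (h : Linked S b p q) :
    Linked S' b (ν p) (ν q) := by
  induction h with
  | refl => exact .refl _ _
  | trans _ _ ih₁ ih₂ => exact ih₁.trans ih₂
  | base h => exact .base (hS _ _ _ h)
  | step h _ ih => exact .step (hS _ _ _ h) ih

theorem mono {S' : Set (Option Bool × N × N)} (hS : S ⊆ S') (h : Linked S b p q) :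
    Linked S' b p q :=
  h.map id fun _ _ _ h => hS h

/-- A chain uses finitely many links, and a property invariant under links that holds at its
beginning holds at all elements occurring in these links. -/
theorem exists_finset {Good : N → Prop} (hS : ∀ k p q, (k, p, q) ∈ S → (Good p ↔ Good q))
    (h : Linked S b p q) :
    (Good p ↔ Good q) ∧ (Good p → ∃ T : Finset (Option Bool × N × N), ↑T ⊆ S ∧
      (∀ l ∈ T, Good l.2.1 ∧ Good l.2.2) ∧ Linked (↑T : Set (Option Bool × N × N)) b p q) := by
  classical
  induction h with
  | refl => exact ⟨.rfl, fun _ => ⟨∅, by simp, by simp, .refl _ _⟩⟩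
  | trans _ _ ih₁ ih₂ =>
    refine ⟨ih₁.1.trans ih₂.1, fun hp => ?_⟩
    obtain ⟨T₁, h₁, g₁, l₁⟩ := ih₁.2 hp
    obtain ⟨T₂, h₂, g₂, l₂⟩ := ih₂.2 (ih₁.1.1 hp)
    refine ⟨T₁ ∪ T₂, by simp [h₁, h₂], ?_, (l₁.mono (by simp)).trans (l₂.mono (by simp))⟩
    intro l hl
    exact (Finset.mem_union.1 hl).elim (g₁ l) (g₂ l)
  | @base b p q h =>
    have hpq := hS _ _ _ h
    exact ⟨hpq, fun hp => ⟨{(some b, p, q)}, by simpa using h, by simpa using ⟨hp, hpq.1 hp⟩,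
      .base (by simp)⟩⟩
  | @step b p q h _ ih =>
    refine ⟨ih.1, fun hp => ?_⟩
    obtain ⟨T, h₁, g₁, l₁⟩ := ih.2 hp
    refine ⟨insert (none, p, q) T, ?_, ?_, .step (by simp) (l₁.mono (by simp))⟩
    · simp [Set.insert_subset_iff, h, h₁]
    · intro l hl
      rcases Finset.mem_insert.1 hl with rfl | hl
      exacts [⟨hp, ih.1.1 hp⟩, g₁ l hl]

/-- Projections that satisfy the links satisfy everything derived from them. -/
theorem collapse_eq (σ : N → Fin 3)
    (hσ : ∀ k p q, (k, p, q) ∈ S → collapse k (σ p) = collapse k (σ q)) (h : Linked S b p q) :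
    collapse (some b) (σ p) = collapse (some b) (σ q) := by
  have key : ∀ (b : Bool) (i j : Fin 3), collapse none i = collapse none j →
      collapse (some !b) i = collapse (some !b) j → collapse (some b) i = collapse (some b) j := by
    decide
  induction h with
  | refl => rfl
  | trans _ _ ih₁ ih₂ => exact ih₁.trans ih₂
  | base h => exact hσ _ _ _ h
  | step h _ ih => exact key _ _ _ (hσ _ _ _ h) ih

/-- The congruences `βₙ` and `γₙ` are obtained by chains of links. -/
theorem of_betaGamma {L : FirstOrder.Language.{u, v}} {A : Type w} [L.Structure A]
    {α β γ : Congruence L A} {S : Set (Option Bool × A × A)}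
    (hα : ∀ a b, α.Rel a b → (none, a, b) ∈ S) (hβ : ∀ a b, β.Rel a b → (some true, a, b) ∈ S)
    (hγ : ∀ a b, γ.Rel a b → (some false, a, b) ∈ S) (n : ℕ) :
    (∀ a b, (betaGamma α β γ n).1.Rel a b → Linked S true a b) ∧
      ∀ a b, (betaGamma α β γ n).2.Rel a b → Linked S false a b := by
  induction n with
  | zero => exact ⟨fun a b h => .base (hβ a b h), fun a b h => .base (hγ a b h)⟩
  | succ n ih =>
    exact ⟨fun a b h => sup_induction (.refl true) (fun _ _ _ => .trans)
        (fun a b h => .base (hβ a b h)) (fun a b h => .step (hα a b h.1) (ih.2 a b h.2)) h,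
      fun a b h => sup_induction (.refl false) (fun _ _ _ => .trans)
        (fun a b h => .base (hγ a b h)) (fun a b h => .step (hα a b h.1) (ih.1 a b h.2)) h⟩

end Linked

/-! ### The identities expressing a chain -/

/-- The elements of a chain from `x` to `z` through `d`. -/
inductive Node : Type
  | x : Node
  | z : Node
  | d : Node
  | f (i : ℕ) : Node

namespace Node

instance : Countable Node := by
  let g : Node → ℕ := fun
    | x => 0
    | z => 1
    | d => 2
    | f i => i + 3
  refine Function.Injective.countable (f := g) ?_
  intro p q h
  cases p <;> cases q <;> simp_all [g]

/-- The abstract ternary term named by a node. -/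
def toTerm : Node → ternaryLanguage.Term (Fin 3)
  | x => Term.var 0
  | z => Term.var 2
  | d => Term.func (L := ternaryLanguage) (l := 3) TernarySymbol.d Term.var
  | f i => Term.func (L := ternaryLanguage) (l := 3) (TernarySymbol.f i) Term.var

/-- The term of the signature `L` named by a node. -/
def interpret {L : FirstOrder.Language.{u, v}} (t : L.Term (Fin 3)) (g : ℕ → L.Term (Fin 3)) :
    Node → L.Term (Fin 3)
  | x => Term.var 0
  | z => Term.var 2
  | d => t
  | f i => g i

end Node

/-- The identity in two variables that expresses a link between nodes. -/
def linkIdentity (l : Option Bool × Node × Node) : TernaryIdentity :=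
  (l.2.1.toTerm.subst fun i => Term.var (collapse l.1 i),
    l.2.2.toTerm.subst fun i => Term.var (collapse l.1 i))

theorem satisfiesInterpreted_linkIdentity_iff {L : FirstOrder.Language.{u, v}} (V : Variety L)
    (t : L.Term (Fin 3)) (g : ℕ → L.Term (Fin 3)) (l : Option Bool × Node × Node) :
    V.SatisfiesInterpreted t g (linkIdentity l) ↔
      ∀ (A : Type u) [L.Structure A] [Nonempty A], V.Mem A → ∀ y : Fin 2 → A,
        (l.2.1.interpret t g).realize (y ∘ collapse l.1) =
          (l.2.2.interpret t g).realize (y ∘ collapse l.1) := by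
  have key : ∀ (p : Node) (A : Type u) [L.Structure A] (y : Fin 2 → A),
      ((p.toTerm.subst fun i => Term.var (collapse l.1 i)).substFunc
        (interpretSymbol t g)).realize y = (p.interpret t g).realize (y ∘ collapse l.1) := by
    intro p A _ y
    cases p with
    | x => rfl
    | z => rfl
    | d => exact Term.realize_subst
    | f i => exact Term.realize_subst
  unfold Variety.SatisfiesInterpreted Variety.Satisfies linkIdentity
  simp only [key]

/-! ### From the identities to a weak difference term -/

section

variable {L : FirstOrder.Language.{u, v}} {A : Type w} [L.Structure A]
  {S : Set (Option Bool × Node × Node)} {d : L.Term (Fin 3)} {f : ℕ → L.Term (Fin 3)}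

theorem realize_const_of_linked
    (hS : ∀ k p q, (k, p, q) ∈ S → ∀ y : Fin 2 → A, (p.interpret d f).realize (y ∘ collapse k) =
      (q.interpret d f).realize (y ∘ collapse k)) {b : Bool} {p q : Node} (h : Linked S b p q)
    (a : A) : (p.interpret d f).realize (fun _ => a) = (q.interpret d f).realize fun _ => a := by
  induction h with
  | refl => rfl
  | trans _ _ ih₁ ih₂ => exact ih₁.trans ih₂
  | base h => exact hS _ _ _ h fun _ => a
  | step h _ ih => exact ih

/-- Over an abelian congruence, the upper right corner of a matrix is determined by the other three
entries: otherwise the nodes could be interpreted by projections in such a way that all the links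
hold, but `x` is not linked to `z` through any projection. -/
theorem eq_of_isMatrix (hfin : S.Finite)
    (hS : ∀ k p q, (k, p, q) ∈ S → ∀ y : Fin 2 → A, (p.interpret d f).realize (y ∘ collapse k) =
      (q.interpret d f).realize (y ∘ collapse k))
    (hidem : ∀ (p : Node) (a : A), (p.interpret d f).realize (fun _ => a) = a)
    (hx : Linked S false .x .d) (hz : Linked S true .d .z)
    {θ : Congruence L A} (hθ : θ.IsAbelian) {e u v a b : A}
    (hu : θ.IsMatrix e u a b) (hv : θ.IsMatrix e v a b) : u = v := by
  classical
  by_contra hne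
  let W : Finset Node := {.x, .z, .d} ∪ (hfin.toFinset.image fun l => l.2.1) ∪
    hfin.toFinset.image fun l => l.2.2
  let g : Fin W.card → L.Term (Fin 3) := fun i => (W.equivFin.symm i).1.interpret d f
  have hg : ∀ i (a : A), (g i).realize (fun _ => a) = a := fun i => hidem _
  obtain ⟨σ, c, hc, hσ⟩ := exists_update_ne (composite g) (θ.trans' (θ.symm' hu.rel_row) hv.rel_row)
    (by rwa [realize_composite_const hg, realize_composite_const hg])
  let τ : Node → Fin 3 := fun p => if h : p ∈ W then σ (W.equivFin ⟨p, h⟩) else 0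
  have key : ∀ {p q : Node} (π π' : Fin 3 → Fin 2), p ∈ W → q ∈ W →
      (∀ y : Fin 2 → A, (p.interpret d f).realize (y ∘ π) = (q.interpret d f).realize (y ∘ π')) →
      π (τ p) = π' (τ q) := by
    intro p q π π' hp hq h
    simp only [τ, hp, hq, dif_pos]
    exact projection_satisfies hθ hg hu hv hc hσ (by simpa [g] using h)
  have hτ : ∀ k p q, (k, p, q) ∈ S → collapse k (τ p) = collapse k (τ q) := by
    intro k p q h
    refine key _ _ ?_ ?_ (hS k p q h)
    · simp only [W, Finset.mem_union, Finset.mem_image, Set.Finite.mem_toFinset]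
      exact .inl (.inr ⟨_, h, rfl⟩)
    · simp only [W, Finset.mem_union, Finset.mem_image, Set.Finite.mem_toFinset]
      exact .inr ⟨_, h, rfl⟩
  -- The nodes `x` and `z` are variables, so their projections are forced: compare `π` with a
  -- constant map that agrees with it at this variable.
  have hx0 := key (p := .x) (q := .x) ![0, 1, 1] ![0, 0, 0] (by simp [W]) (by simp [W])
    fun _ => rfl
  have hz2 := key (p := .z) (q := .z) ![1, 1, 0] ![0, 0, 0] (by simp [W]) (by simp [W])
    fun _ => rfl
  have h₁ := hx.collapse_eq τ hτ
  have h₂ := hz.collapse_eq τ hτ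
  generalize τ .x = i at *
  generalize τ .d = j at *
  generalize τ .z = k at *
  revert i j k
  decide

theorem isMatrix_realize {θ : Congruence L A} (t : L.Term (Fin 3)) (a : A) {b b' c c' : A}
    (hb : θ.Rel b b') (hc : θ.Rel c c') :
    θ.IsMatrix (t.realize ![a, b, c]) (t.realize ![a, b, c']) (t.realize ![a, b', c])
      (t.realize ![a, b', c']) := by
  have key : ∀ b c : A, (t.relabel ![Sum.inl 0, Sum.inl 1, Sum.inr ()] :
      L.Term (Fin 2 ⊕ Unit)).realize (Sum.elim ![a, b] fun _ => c) = t.realize ![a, b, c] := by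
    intro b c
    rw [Term.realize_relabel]
    congr 1
    funext i
    fin_cases i <;> rfl
  have h := IsMatrix.of_term (θ := θ) (t.relabel ![Sum.inl 0, Sum.inl 1, Sum.inr ()] :
      L.Term (Fin 2 ⊕ Unit)) (a := ![a, b]) (b := ![a, b']) (c := fun _ => c) (d := fun _ => c')
    (by intro i; fin_cases i; exacts [θ.refl' a, hb]) (fun _ => hc)
  rwa [key, key, key, key] at h

theorem comp_collapse (a c : A) :
    ![a, c] ∘ collapse none = ![a, c, a] ∧ ![a, c] ∘ collapse (some true) = ![a, a, c] ∧
      ![a, c] ∘ collapse (some false) = ![a, c, c] := by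
  refine ⟨?_, ?_, ?_⟩ <;>
  · funext i
    fin_cases i <;> rfl

/-- Over an abelian congruence, linked nodes agree after identifying two of their variables: an
`α`-link and a link of the other kind give three corners of a matrix. -/
theorem realize_collapse_eq_of_linked (hfin : S.Finite)
    (hS : ∀ k p q, (k, p, q) ∈ S → ∀ y : Fin 2 → A, (p.interpret d f).realize (y ∘ collapse k) =
      (q.interpret d f).realize (y ∘ collapse k))
    (hidem : ∀ (p : Node) (a : A), (p.interpret d f).realize (fun _ => a) = a)
    (hx : Linked S false .x .d) (hz : Linked S true .d .z)
    {θ : Congruence L A} (hθ : θ.IsAbelian) {a c : A} (hac : θ.Rel a c) {b : Bool} {p q : Node}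
    (h : Linked S b p q) :
    (p.interpret d f).realize (![a, c] ∘ collapse (some b)) =
      (q.interpret d f).realize (![a, c] ∘ collapse (some b)) := by
  obtain ⟨e₀, e₁, e₂⟩ := comp_collapse a c
  have hconst : ∀ p : Node, (p.interpret d f).realize ![a, a, a] = a := by
    intro p
    refine Eq.trans ?_ (hidem p a)
    congr 1
    funext i
    fin_cases i <;> rfl
  induction h with
  | refl => rfl
  | trans _ _ ih₁ ih₂ => exact ih₁.trans ih₂
  | base h => exact hS _ _ _ h _
  | @step b p q h _ ih =>
    have hα := hS _ _ _ h ![a, c]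
    rw [e₀] at hα
    cases b
    · rw [Bool.not_false, e₁] at ih
      rw [e₂]
      have hp := isMatrix_realize (p.interpret d f) a (θ.symm' hac) hac
      have hq := isMatrix_realize (q.interpret d f) a (θ.symm' hac) hac
      rw [hα, hconst, ih] at hp
      rw [hconst] at hq
      exact eq_of_isMatrix hfin hS hidem hx hz hθ hp hq
    · rw [Bool.not_true, e₂] at ih
      rw [e₁]
      have hp := isMatrix_realize (p.interpret d f) a hac hac
      have hq := isMatrix_realize (q.interpret d f) a hac hac
      rw [hα, hconst, ih] at hp
      rw [hconst] at hq
      exact eq_of_isMatrix hfin hS hidem hx hz hθ hp hq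

end

theorem isWeakDifferenceTerm_of_linked {L : FirstOrder.Language.{u, v}} [L.IsAlgebraic]
    {V : Variety L} {d : L.Term (Fin 3)} {f : ℕ → L.Term (Fin 3)}
    {S : Set (Option Bool × Node × Node)} (hfin : S.Finite)
    (hx : Linked S false .x .d) (hz : Linked S true .d .z) (hf : ∀ i, V.IsIdempotent (f i))
    (hS : ∀ l ∈ S, V.SatisfiesInterpreted d f (linkIdentity l)) : V.IsWeakDifferenceTerm d := by
  have hS' : ∀ (A : Type u) [L.Structure A] [Nonempty A], V.Mem A → ∀ k p q, (k, p, q) ∈ S →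
      ∀ y : Fin 2 → A, (p.interpret d f).realize (y ∘ collapse k) =
        (q.interpret d f).realize (y ∘ collapse k) :=
    fun A _ _ hA k p q h => (satisfiesInterpreted_linkIdentity_iff V d f _).1 (hS _ h) A hA
  have hidem : ∀ (A : Type u) [L.Structure A] [Nonempty A], V.Mem A → ∀ (p : Node) (a : A),
      (p.interpret d f).realize (fun _ => a) = a := by
    intro A _ _ hA p a
    cases p with
    | x => rfl
    | z => rfl
    | d => exact (realize_const_of_linked (hS' A hA) hx a).symm
    | f i =>
      have := hf i A hA fun _ => a
      rwa [Term.realize_subst] at this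
  intro A _ _ hA
  refine ⟨fun a => ?_, fun δ θ hle hab => ?_⟩
  · refine Eq.trans ?_ (hidem A hA .d a)
    change d.realize _ = d.realize _
    congr 1
    funext i
    fin_cases i <;> rfl
  have hQ := hA.quot δ
  have hne : Nonempty δ.Quot := ⟨Quotient.mk _ (Classical.arbitrary A)⟩
  have hmk : ∀ a b c : A, d.realize ![Quotient.mk δ.toSetoid a, Quotient.mk δ.toSetoid b,
      Quotient.mk δ.toSetoid c] = Quotient.mk δ.toSetoid (d.realize ![a, b, c]) := by
    intro a b c
    rw [← Term.realize_quotient_mk']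
    congr 1
    funext i
    fin_cases i <;> rfl
  have key : ∀ a b : A, θ.Rel a b →
      δ.Rel (d.realize ![a, a, b]) b ∧ δ.Rel a (d.realize ![a, b, b]) := by
    intro a b h
    have hmod : (θ.modulo δ hle).Rel (Quotient.mk _ a) (Quotient.mk _ b) := ⟨a, b, rfl, rfl, h⟩
    have h₁ := realize_collapse_eq_of_linked hfin (hS' _ hQ) (hidem _ hQ) hx hz hab hmod hx
    have h₂ := realize_collapse_eq_of_linked hfin (hS' _ hQ) (hidem _ hQ) hx hz hab hmod hz
    rw [(comp_collapse _ _).2.2] at h₁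
    rw [(comp_collapse _ _).2.1] at h₂
    exact ⟨Quotient.exact ((hmk a a b).symm.trans h₂), Quotient.exact (h₁.trans (hmk a b b))⟩
  exact fun a b h => ⟨(key a b h).1, (key b a (θ.symm' h)).2⟩

/-! ### The free algebra on three generators -/

section

variable {L : FirstOrder.Language.{u, v}} [L.IsAlgebraic] {V : Variety L} {d : L.Term (Fin 3)}

theorem exists_freeBetaGamma (h : V.IsWeakDifferenceTerm d) :
    ∃ m : ℕ, (V.freeBetaGamma m).2.Rel (V.gen 0) (V.freeElement d) ∧
      (V.freeBetaGamma m).1.Rel (V.freeElement d) (V.gen 2) := by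
  set x := V.gen (0 : Fin 3)
  set y := V.gen (1 : Fin 3)
  set z := V.gen (2 : Fin 3)
  have hαβγ : cg L x z ≤ cg L x y ⊔ cg L y z :=
    cg_le (Setoid.trans' _ ((le_sup_left : _ ≤ cg L x y ⊔ cg L y z) _ _ (cg_rel x y))
      ((le_sup_right : _ ≤ cg L x y ⊔ cg L y z) _ _ (cg_rel y z)))
  obtain ⟨δ, hle, hab, hδ⟩ := exists_isAbelian_modulo_betaGamma hαβγ
  have hne : Nonempty (V.Free (Fin 3)) := ⟨x⟩
  have hd := (h _ (V.mem_free (Fin 3))).2 δ _ hle hab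
  obtain ⟨m, hm, -⟩ := hδ _ _ (hd x z (cg_rel x z)).1
  obtain ⟨n, -, hn⟩ := hδ _ _ (hd z x (Setoid.symm' _ (cg_rel x z))).2
  have hmono := betaGamma_mono (cg L x z) (cg L x y) (cg L y z)
  have h₁ : (V.freeBetaGamma m).1.Rel (V.freeElement d) (d.realize ![x, x, z]) := by
    refine (hmono (Nat.zero_le m)).1 _ _ ((cg L x y).realize_rel d fun i => ?_)
    fin_cases i
    exacts [Setoid.refl' _ _, Setoid.symm' _ (cg_rel x y), Setoid.refl' _ _]
  have h₂ : (V.freeBetaGamma n).2.Rel (d.realize ![x, z, z]) (V.freeElement d) := by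
    refine (hmono (Nat.zero_le n)).2 _ _ ((cg L y z).realize_rel d fun i => ?_)
    fin_cases i
    exacts [Setoid.refl' _ _, Setoid.symm' _ (cg_rel y z), Setoid.refl' _ _]
  exact ⟨max m n, (hmono (le_max_right m n)).2 _ _ (Setoid.trans' _ hn h₂),
    (hmono (le_max_left m n)).1 _ _ (Setoid.trans' _ h₁ hm)⟩

/-- The congruences `α`, `β` and `γ` of the free algebra, indexed as in `collapse`. -/
def freeCongr (V : Variety L) : Option Bool → Congruence L (V.Free (Fin 3))
  | none => cg L (V.gen 0) (V.gen 2)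
  | some true => cg L (V.gen 0) (V.gen 1)
  | some false => cg L (V.gen 1) (V.gen 2)

theorem eval_eq_of_freeCongr {A : Type u} [L.Structure A] [Nonempty A] (hA : V.Mem A)
    (y : Fin 2 → A) {k : Option Bool} {P Q : V.Free (Fin 3)} (h : (freeCongr V k).Rel P Q) :
    Variety.eval hA (y ∘ collapse k) P = Variety.eval hA (y ∘ collapse k) Q := by
  have hle : freeCongr V k ≤ Variety.evalKer hA (y ∘ collapse k) := by
    rcases k with _ | _ | _
    all_goals exact cg_le rfl
  exact hle _ _ h

/-- The chains witnessing that `(x, d)` is in some `γₘ` and `(d, z)` in some `βₘ` involve finitely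
many elements of the free algebra, all of them idempotent; terms representing them are taken
for the `fᵢ`. -/
theorem exists_linked {m : ℕ} (hx : (V.freeBetaGamma m).2.Rel (V.gen 0) (V.freeElement d))
    (hz : (V.freeBetaGamma m).1.Rel (V.freeElement d) (V.gen 2)) :
    ∃ (S : Finset (Option Bool × Node × Node)) (f : ℕ → L.Term (Fin 3)),
      Linked (↑S : Set (Option Bool × Node × Node)) false .x .d ∧
      Linked (↑S : Set (Option Bool × Node × Node)) true .d .z ∧ (∀ i, V.IsIdempotent (f i)) ∧
      ∀ l ∈ S, V.SatisfiesInterpreted d f (linkIdentity l) := by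
  classical
  set X := V.gen (0 : Fin 3)
  set Z := V.gen (2 : Fin 3)
  set D := V.freeElement d with hD
  let S₀ : Set (Option Bool × V.Free (Fin 3) × V.Free (Fin 3)) :=
    {l | (freeCongr V l.1).Rel l.2.1 l.2.2}
  have hlink := Linked.of_betaGamma (S := S₀) (α := cg L X Z) (β := cg L X (V.gen 1))
    (γ := cg L (V.gen 1) Z) (fun _ _ h => h) (fun _ _ h => h) (fun _ _ h => h) m
  have hgood : ∀ k P Q, (k, P, Q) ∈ S₀ → (Variety.Idempotent P ↔ Variety.Idempotent Q) := by
    intro k P Q h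
    have hev : ∀ (A : Type u) [L.Structure A] [Nonempty A] (hA : V.Mem A) (a : A),
        Variety.eval hA (fun _ => a) P = Variety.eval hA (fun _ => a) Q :=
      fun A _ _ hA a => eval_eq_of_freeCongr hA (fun _ => a) h
    exact ⟨fun h A _ _ hA a => (hev A hA a).symm.trans (h A hA a),
      fun h A _ _ hA a => (hev A hA a).trans (h A hA a)⟩
  have hX : Variety.Idempotent X := fun A _ _ hA a => rfl
  obtain ⟨hXD, hT₁⟩ := (hlink.2 _ _ hx).exists_finset hgood
  obtain ⟨hDZ, hT₂⟩ := (hlink.1 _ _ hz).exists_finset hgood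
  obtain ⟨T₁, s₁, g₁, l₁⟩ := hT₁ hX
  obtain ⟨T₂, s₂, g₂, l₂⟩ := hT₂ (hXD.1 hX)
  let T := T₁ ∪ T₂
  let W : Finset (V.Free (Fin 3)) := {X, D, Z} ∪ (T.image fun l => l.2.1) ∪ T.image fun l => l.2.2
  have hWgood : ∀ P ∈ W, Variety.Idempotent P := by
    have hT : ∀ l ∈ T, Variety.Idempotent l.2.1 ∧ Variety.Idempotent l.2.2 :=
      fun l hl => (Finset.mem_union.1 hl).elim (g₁ l) (g₂ l)
    intro P hP
    simp only [W, Finset.mem_union, Finset.mem_insert, Finset.mem_singleton,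
      Finset.mem_image] at hP
    rcases hP with ((rfl | rfl | rfl) | ⟨l, hl, rfl⟩) | ⟨l, hl, rfl⟩
    exacts [hX, hXD.1 hX, hDZ.1 (hXD.1 hX), (hT l hl).1, (hT l hl).2]
  obtain ⟨e, he⟩ := W.finite_toSet.countable.exists_eq_range ⟨X, by simp [W]⟩
  have hidx : ∀ P, ∃ i, P ∈ W → e i = P := by
    intro P
    by_cases hP : P ∈ W
    · obtain ⟨i, hi⟩ : P ∈ Set.range e := he ▸ hP
      exact ⟨i, fun _ => hi⟩
    · exact ⟨0, fun h => absurd h hP⟩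
  choose idx hidx using hidx
  let f : ℕ → L.Term (Fin 3) := fun i => (e i).out
  have hef : ∀ i, Quotient.mk (V.freeCongruence (Fin 3)).toSetoid (f i) = e i :=
    fun i => (e i).out_eq
  have heD : Quotient.mk (V.freeCongruence (Fin 3)).toSetoid d = D := by
    rw [hD, ← V.realize_gen, Variety.freeElement]
    congr 1
    funext i
    fin_cases i <;> rfl
  let val : Node → V.Free (Fin 3) := fun p => Quotient.mk _ (p.interpret d f)
  have hval : ∀ P ∈ W, val (.f (idx P)) = P := fun P hP => (hef _).trans (hidx P hP)
  have hXW : X ∈ W := by simp [W]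
  have hDW : D ∈ W := by simp [W]
  have hZW : Z ∈ W := by simp [W]
  let S' : Finset (Option Bool × Node × Node) :=
    T.image fun l => (l.1, .f (idx l.2.1), .f (idx l.2.2))
  let S : Finset (Option Bool × Node × Node) :=
    S' ∪ {(some false, .x, .f (idx X)), (some false, .f (idx D), .d),
      (some true, .d, .f (idx D)), (some true, .f (idx Z), .z)}
  have hTS : ∀ k P Q, (k, P, Q) ∈ T → (k, Node.f (idx P), Node.f (idx Q)) ∈ S := by
    intro k P Q h
    exact Finset.mem_union_left _ (Finset.mem_image.2 ⟨_, h, rfl⟩)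
  refine ⟨S, f, ?_, ?_, ?_, ?_⟩
  · refine .trans (.base (q := .f (idx X)) (by simp [S]))
      (.trans (q := .f (idx D)) ?_ (.base (by simp [S])))
    exact l₁.map (fun P => Node.f (idx P)) fun k P Q h => hTS k P Q (Finset.mem_union_left _ h)
  · refine .trans (.base (q := .f (idx D)) (by simp [S]))
      (.trans (q := .f (idx Z)) ?_ (.base (by simp [S])))
    exact l₂.map (fun P => Node.f (idx P)) fun k P Q h => hTS k P Q (Finset.mem_union_right _ h)
  · intro i
    refine Variety.isIdempotent_of_idempotent ?_
    rw [hef]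
    refine hWgood _ ?_
    rw [← Finset.mem_coe, he]
    exact ⟨i, rfl⟩
  · have hS : ∀ l ∈ S, (freeCongr V l.1).Rel (val l.2.1) (val l.2.2) := by
      intro l hl
      have heq : ∀ {k : Option Bool} {P Q : V.Free (Fin 3)}, P = Q → (freeCongr V k).Rel P Q := by
        rintro k P _ rfl
        exact Setoid.refl' _ P
      simp only [S, S', Finset.mem_union, Finset.mem_image, Finset.mem_insert,
        Finset.mem_singleton] at hl
      rcases hl with ⟨⟨k, P, Q⟩, h, rfl⟩ | rfl | rfl | rfl | rfl
      · have hP : P ∈ W := Finset.mem_union_left _ (Finset.mem_union_right _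
          (Finset.mem_image.2 ⟨_, h, rfl⟩))
        have hQ : Q ∈ W := Finset.mem_union_right _ (Finset.mem_image.2 ⟨_, h, rfl⟩)
        simp only [hval P hP, hval Q hQ]
        exact (Finset.mem_union.1 h).elim (fun h => s₁ h) (fun h => s₂ h)
      · exact heq (hval X hXW).symm
      · exact heq ((hval D hDW).trans heD.symm)
      · exact heq (heD.trans (hval D hDW).symm)
      · exact heq (hval Z hZW)
    intro l hl
    rw [satisfiesInterpreted_linkIdentity_iff]
    exact fun A _ _ hA y => eval_eq_of_freeCongr hA y (hS l hl)

end

end UnivAlg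

theorem mainTheorem10 :
    ∃ Sig : ℕ → Set UnivAlg.TernaryIdentity,
      (∀ n : ℕ, (Sig n).Finite) ∧
      ∀ (L : FirstOrder.Language.{u, v}) [L.IsAlgebraic] (V : UnivAlg.Variety L)
        (d : L.Term (Fin 3)),
        List.TFAE [
          V.IsWeakDifferenceTerm d,
          (∃ n : ℕ, ∃ f : ℕ → L.Term (Fin 3), (∀ i : ℕ, V.IsIdempotent (f i)) ∧
            ∀ e ∈ Sig n, V.SatisfiesInterpreted d f e),
          (∃ m : ℕ, (V.freeBetaGamma m).2.Rel (V.gen 0) (V.freeElement d) ∧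
            (V.freeBetaGamma m).1.Rel (V.freeElement d) (V.gen 2))] := by
  classical
  -- `Sig` enumerates the finite sets of links from which a chain from `x` to `z` can be derived.
  let Link := Option Bool × UnivAlg.Node × UnivAlg.Node
  let Chains : Set (Finset Link) := {S |
    UnivAlg.Linked (↑S : Set Link) false UnivAlg.Node.x UnivAlg.Node.d ∧
    UnivAlg.Linked (↑S : Set Link) true UnivAlg.Node.d UnivAlg.Node.z}
  have hne : Chains.Nonempty :=
    ⟨{(some false, UnivAlg.Node.x, UnivAlg.Node.d), (some true, UnivAlg.Node.d, UnivAlg.Node.z)},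
      .base (by simp), .base (by simp)⟩
  obtain ⟨s, hs⟩ := (Set.to_countable Chains).exists_eq_range hne
  refine ⟨fun n => UnivAlg.linkIdentity '' (↑(s n) : Set Link),
    fun n => (s n).finite_toSet.image _, ?_⟩
  intro L _ V d
  tfae_have 1 → 3 := UnivAlg.exists_freeBetaGamma
  tfae_have 3 → 2 := by
    rintro ⟨m, hx, hz⟩
    obtain ⟨S, f, h₁, h₂, hf, hS⟩ := UnivAlg.exists_linked hx hz
    obtain ⟨n, rfl⟩ : S ∈ Set.range s := hs ▸ ⟨h₁, h₂⟩
    refine ⟨n, f, hf, ?_⟩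
    rintro _ ⟨l, hl, rfl⟩
    exact hS l hl
  tfae_have 2 → 1 := by
    rintro ⟨n, f, hf, hS⟩
    have hn : s n ∈ Chains := hs ▸ ⟨n, rfl⟩
    exact UnivAlg.isWeakDifferenceTerm_of_linked (s n).finite_toSet hn.1 hn.2 hf
      fun l hl => hS _ ⟨l, hl, rfl⟩
  tfae_finish
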